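/- Let $P,Q\in\mathbb R^2$, $\alpha\in(0,1)$, and let $\overline\gamma:[0,1]\to\mathbb R^2$ be a regular parametrized plane curve of class $C^{4+\alpha}$ with $\overline\gamma(0)=P$, $\overline\gamma(1)=Q$ and with curvature $\kappa_{\overline\gamma}(0)=\kappa_{\overline\gamma}(1)=0$. For a regular plane curve $c:[0,1]\to\mathbb R^2$ write $ds=|\partial_xc|\,dx$, $\partial_s=|\partial_xc|^{-1}\partial_x$, $\tau_c=\partial_sc$, $\nu_c$ for the counterclockwise rotation of $\tau_c$ by $\pi/2$, and $\kappa_c$ for the curvature, $\partial_s^2c=\kappa_c\nu_c$. For $\varepsilon\in(0,1]$, a solution of the $\varepsilon$-elastic flow starting from $\overline\gamma$ is a family of regular curves $\gamma_\varepsilon(t):[0,1]\to\mathbb R^2$, $t\in[0,\infty)$, such that $(t,x)\mapsto\gamma_\varepsilon(t)(x)$ is $C^\infty$ on $(0,\infty)\times[0,1]$, its space derivatives of order at most $2$ are continuous on $[0,\infty)\times[0,1]$, and $$(\partial_t\gamma_\varepsilon)^\perp=\Big(\kappa_{\gamma_\varepsilon(t)}-\varepsilon\big(2\partial_s^2\kappa_{\gamma_\varepsilon(t)}+\kappa_{\gamma_\varepsilon(t)}^3\big)\Big)\nu_{\gamma_\varepsilon(t)}\quad\text{on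 }(0,\infty)\times[0,1],$$ $$\gamma_\varepsilon(t)(0)=P,\quad \gamma_\varepsilon(t)(1)=Q,\quad \kappa_{\gamma_\varepsilon(t)}(0)=\kappa_{\gamma_\varepsilon(t)}(1)=0\quad (t\ge0),\qquad \gamma_\varepsilon(0)=\overline\gamma,$$ where $\perp$ denotes the component orthogonal to $\tau_{\gamma_\varepsilon(t)}$ (the tangential component of the velocity is not prescribed). Then there exists $T_{\max}>0$ such that, for every $T\in(0,T_{\max})$, $$\sup_{\varepsilon\in(0,1]}\ \sup_{t\in[0,T]}\ \int_{\gamma_\varepsilon(t)}\kappa_{\gamma_\varepsilon(t)}^2\,ds<+\infty,$$ where $T_{\max}$ and the bound depend only on $\overline\gamma$ (the bound also on $T$) and not on the choice of the solutions $\gamma_\varepsilon$. -/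

import Mathlib

open Set
open scoped ContDiff NNReal

noncomputable section

namespace ElasticFlow

/-- The Euclidean plane. -/
abbrev Plane : Type := EuclideanSpace ℝ (Fin 2)

/-- The parameter interval `[0, 1]`.  All space derivatives are taken within it, hence one-sided
at its endpoints; only the values of a curve on this interval matter. -/
abbrev I : Set ℝ := Icc 0 1

/-- Counterclockwise rotation of the plane by `π / 2`. -/
def rot (v : Plane) : Plane := !₂[-(v 1), v 0]

/-- The speed `|∂ₓ c|` of a parametrized plane curve. -/
def speed (c : ℝ → Plane) (x : ℝ) : ℝ := ‖derivWithin c I x‖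

/-- Differentiation `∂ₛ = |∂ₓ c|⁻¹ ∂ₓ` with respect to the arclength parameter of `c`. -/
def arcDeriv {F : Type*} [NormedAddCommGroup F] [NormedSpace ℝ F]
    (c : ℝ → Plane) (f : ℝ → F) (x : ℝ) : F :=
  (speed c x)⁻¹ • derivWithin f I x

/-- The unit tangent `τ = ∂ₛ c`. -/
def tangent (c : ℝ → Plane) : ℝ → Plane := arcDeriv c c

/-- The unit normal `ν`, the counterclockwise rotation of `τ` by `π / 2`. -/
def normal (c : ℝ → Plane) (x : ℝ) : Plane := rot (tangent c x)

/-- The curvature `κ`, given by `∂ₛ² c = κ ν`; that is, `κ = ⟨∂ₛ τ, ν⟩`. -/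
def curvature (c : ℝ → Plane) (x : ℝ) : ℝ := inner ℝ (arcDeriv c (tangent c) x) (normal c x)

/-- The integral `∫_c f ds` of a function along a curve, where `ds = |∂ₓ c| dx`. -/
def arcIntegral (c : ℝ → Plane) (f : ℝ → ℝ) : ℝ := ∫ x in (0 : ℝ)..1, f x * speed c x

/-- The part of the vector `v` orthogonal to the tangent of `c` at the parameter `x`. -/
def perpPart (c : ℝ → Plane) (x : ℝ) (v : Plane) : Plane :=
  v - (inner ℝ v (tangent c x) : ℝ) • tangent c x

/-- Admissible initial curves: regular plane curves of class `C^{4+α}` from `P` to `Q` whose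
curvature vanishes at both endpoints. -/
structure IsInitialCurve (α : ℝ≥0) (P Q : Plane) (c : ℝ → Plane) : Prop where
  contDiffOn : ContDiffOn ℝ 4 c I
  holder : ∃ K : ℝ≥0, HolderOnWith K α (iteratedDerivWithin 4 c I) I
  regular : ∀ x ∈ I, derivWithin c I x ≠ 0
  left : c 0 = P
  right : c 1 = Q
  curvature_left : curvature c 0 = 0
  curvature_right : curvature c 1 = 0

/-- `Y t x`, for `t ∈ [0, ∞)` and `x ∈ [0, 1]`, is a solution of the `ε`-elastic flow of curves
joining `P` to `Q`, with zero curvature at the endpoints and with initial curve `c₀`.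
The parametrization is arbitrary, that is, the tangential velocity is not prescribed; this
includes the parametrization proportional to arclength.  Solutions are smooth for positive
times and of class `C²` in space continuously up to the initial time. -/
structure IsSolution (ε : ℝ) (P Q : Plane) (c₀ : ℝ → Plane) (Y : ℝ → ℝ → Plane) : Prop where
  smooth : ContDiffOn ℝ ∞ (fun p : ℝ × ℝ => Y p.1 p.2) (Ioi 0 ×ˢ I)
  continuousOn : ∀ j ≤ 2,
    ContinuousOn (fun p : ℝ × ℝ => iteratedDerivWithin j (Y p.1) I p.2) (Ici 0 ×ˢ I)
  regular : ∀ t, 0 ≤ t → ∀ x ∈ I, derivWithin (Y t) I x ≠ 0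
  evolution : ∀ t, 0 < t → ∀ x ∈ I,
    perpPart (Y t) x (deriv (fun s => Y s x) t) =
      (curvature (Y t) x
        - ε * (2 * arcDeriv (Y t) (arcDeriv (Y t) (curvature (Y t))) x
          + curvature (Y t) x ^ 3)) • normal (Y t) x
  left : ∀ t, 0 ≤ t → Y t 0 = P
  right : ∀ t, 0 ≤ t → Y t 1 = Q
  curvature_left : ∀ t, 0 ≤ t → curvature (Y t) 0 = 0
  curvature_right : ∀ t, 0 ≤ t → curvature (Y t) 1 = 0
  initial : ∀ x ∈ I, Y 0 x = c₀ x

end ElasticFlow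

end

/-!
Along the flow the elastic energy `E(t) = ∫ κ² ds` satisfies a differential inequality that does not
involve `ε`, so it stays bounded up to a time depending on `E(0)` only.

Let `V` and `Λ` be the normal and tangential velocities and `ω` the rate at which the tangent turns.
For an arbitrary smooth family of regular curves the energy density obeys
`∂ₜ(κ²|∂ₓY|) = ∂ₓ(2κω - κ²Λ - 2(∂ₛκ)V) + (2∂ₛ²κ + κ³) V |∂ₓY|`
(`IsRegularFamily.dt_energyDensity`). At the endpoints the curvature vanishes, and so does `V` because
the endpoints are fixed; hence the flux does not contribute, whatever the tangential velocity is.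
Inserting `V = κ - ε(2∂ₛ²κ + κ³)` produces a term `-ε ∫ (2∂ₛ²κ + κ³)² ds ≤ 0`, which is dropped, and
an integration by parts leaves `E' ≤ -2 ∫ (∂ₛκ)² ds + ∫ κ⁴ ds`.

Since `κ` vanishes at an endpoint, `κ²` is bounded by `r E + r⁻¹ ∫ (∂ₛκ)² ds` for all `r > 0`
(`IsRegularFamily.curvature_sq_le`). With `r = (E + 1) / 2` this absorbs the quartic term and gives
`E' ≤ (E + 1)³ / 2` (`IsSolution.hasDerivAt_bendingEnergy`), so `(E + 1)⁻² + t` is nondecreasing for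
positive times. The energy is continuous up to `t = 0`, because the curvature depends on the first two
space derivatives only (`IsSolution.continuousOn_bendingEnergy`). Therefore
`E(t) ≤ ((E(0) + 1)⁻² - T)⁻¹` for `t ≤ T < (E(0) + 1)⁻²` (`IsSolution.bendingEnergy_le`), where `E(0)`
is the energy of the initial curve.
-/

noncomputable section

namespace ElasticFlow

/-! ### Calculus on the strip -/

variable {F : Type*} [NormedAddCommGroup F] [NormedSpace ℝ F]

/-- Positive times and parameters in `[0, 1]`: the set on which solutions of the flow are smooth. -/
abbrev strip : Set (ℝ × ℝ) := Ioi 0 ×ˢ I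

/-- Smoothness of a curried function of `(t, x)` on the strip, up to the boundary parts `x = 0` and
`x = 1`. -/
def SmoothOnStrip (f : ℝ → ℝ → F) : Prop :=
  ContDiffOn ℝ ∞ (fun p : ℝ × ℝ => f p.1 p.2) strip

/-- The parameter derivative `∂ₓ f`, taken within `[0, 1]` and so one-sided at the endpoints. -/
def dx (f : ℝ → ℝ → F) (t x : ℝ) : F := derivWithin (f t) I x

/-- The time derivative `∂ₜ f`; it is two-sided, as the times of interest are positive. -/
def dt (f : ℝ → ℝ → F) (t x : ℝ) : F := deriv (fun s => f s x) t

theorem uniqueDiffOn_interval : UniqueDiffOn ℝ I := uniqueDiffOn_Icc zero_lt_one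

theorem uniqueDiffOn_strip : UniqueDiffOn ℝ strip :=
  isOpen_Ioi.uniqueDiffOn.prod uniqueDiffOn_interval

theorem strip_subset_closure_interior : strip ⊆ closure (interior strip) := by
  rw [interior_prod_eq, closure_prod_eq, interior_Ioi, interior_Icc,
    closure_Ioo zero_ne_one]
  exact prod_mono subset_closure subset_rfl

namespace SmoothOnStrip

variable {f g : ℝ → ℝ → F} {t x : ℝ}

theorem hasDerivWithinAt_fderivWithin (hf : SmoothOnStrip f) (ht : 0 < t) (hx : x ∈ I) :
    HasDerivWithinAt (f t)
      (fderivWithin ℝ (fun p : ℝ × ℝ => f p.1 p.2) strip (t, x) (0, 1)) I x := by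
  have h := ((hf.differentiableOn (by simp)) (t, x) ⟨ht, hx⟩).hasFDerivWithinAt
  have hc : HasDerivWithinAt (fun y : ℝ => (t, y)) ((0 : ℝ), (1 : ℝ)) I x :=
    (hasDerivWithinAt_const x I t).prodMk (hasDerivWithinAt_id x I)
  exact h.comp_hasDerivWithinAt x hc (fun y hy => ⟨ht, hy⟩)

theorem hasDerivAt_fderivWithin (hf : SmoothOnStrip f) (ht : 0 < t) (hx : x ∈ I) :
    HasDerivAt (fun s => f s x)
      (fderivWithin ℝ (fun p : ℝ × ℝ => f p.1 p.2) strip (t, x) (1, 0)) t := by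
  have h := ((hf.differentiableOn (by simp)) (t, x) ⟨ht, hx⟩).hasFDerivWithinAt
  have hc : HasDerivWithinAt (fun s : ℝ => (s, x)) ((1 : ℝ), (0 : ℝ)) (Ioi 0) t :=
    (hasDerivWithinAt_id t _).prodMk (hasDerivWithinAt_const t _ x)
  have hm : MapsTo (fun s : ℝ => (s, x)) (Ioi 0) strip := fun s hs => ⟨hs, hx⟩
  exact (h.comp_hasDerivWithinAt t hc hm).hasDerivAt (Ioi_mem_nhds ht)

theorem dx_eq (hf : SmoothOnStrip f) (ht : 0 < t) (hx : x ∈ I) :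
    dx f t x = fderivWithin ℝ (fun p : ℝ × ℝ => f p.1 p.2) strip (t, x) (0, 1) :=
  (hf.hasDerivWithinAt_fderivWithin ht hx).derivWithin (uniqueDiffOn_interval x hx)

theorem dt_eq (hf : SmoothOnStrip f) (ht : 0 < t) (hx : x ∈ I) :
    dt f t x = fderivWithin ℝ (fun p : ℝ × ℝ => f p.1 p.2) strip (t, x) (1, 0) :=
  (hf.hasDerivAt_fderivWithin ht hx).deriv

theorem hasDerivWithinAt (hf : SmoothOnStrip f) (ht : 0 < t) (hx : x ∈ I) :
    HasDerivWithinAt (f t) (ElasticFlow.dx f t x) I x := by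
  rw [hf.dx_eq ht hx]; exact hf.hasDerivWithinAt_fderivWithin ht hx

theorem hasDerivAt (hf : SmoothOnStrip f) (ht : 0 < t) (hx : x ∈ I) :
    HasDerivAt (fun s => f s x) (ElasticFlow.dt f t x) t := by
  rw [hf.dt_eq ht hx]; exact hf.hasDerivAt_fderivWithin ht hx

theorem congr (hf : SmoothOnStrip f) (h : ∀ t, 0 < t → ∀ x ∈ I, g t x = f t x) :
    SmoothOnStrip g :=
  ContDiffOn.congr hf fun p hp => h p.1 hp.1 p.2 hp.2

theorem contDiffOn_fderivWithin (hf : SmoothOnStrip f) :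
    ContDiffOn ℝ ∞ (fderivWithin ℝ (fun p : ℝ × ℝ => f p.1 p.2) strip) strip :=
  ContDiffOn.fderivWithin hf uniqueDiffOn_strip (by simp)

theorem dx (hf : SmoothOnStrip f) : SmoothOnStrip (dx f) :=
  ContDiffOn.congr (hf.contDiffOn_fderivWithin.clm_apply contDiffOn_const)
    fun _ hp => hf.dx_eq hp.1 hp.2

theorem dt (hf : SmoothOnStrip f) : SmoothOnStrip (dt f) :=
  ContDiffOn.congr (hf.contDiffOn_fderivWithin.clm_apply contDiffOn_const)
    fun _ hp => hf.dt_eq hp.1 hp.2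

/-- Mixed derivatives commute on the strip, also at the endpoints of `[0, 1]`: the strip lies in the
closure of its interior, which suffices for the symmetry of the second derivative. -/
theorem dt_dx (hf : SmoothOnStrip f) (ht : 0 < t) (hx : x ∈ I) :
    ElasticFlow.dt (ElasticFlow.dx f) t x = ElasticFlow.dx (ElasticFlow.dt f) t x := by
  have hp : (t, x) ∈ strip := ⟨ht, hx⟩
  have hu := uniqueDiffOn_strip (t, x) hp
  have hd := (hf.contDiffOn_fderivWithin.differentiableOn (by simp)) (t, x) hp
  have key : ∀ w : ℝ × ℝ, fderivWithin ℝ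
      (fun p => fderivWithin ℝ (fun p : ℝ × ℝ => f p.1 p.2) strip p w) strip (t, x) =
      (fderivWithin ℝ (fderivWithin ℝ (fun p : ℝ × ℝ => f p.1 p.2) strip) strip (t, x)).flip w := by
    intro w
    rw [fderivWithin_clm_apply hu hd (differentiableWithinAt_const w)]
    simp
  rw [hf.dx.dt_eq ht hx, hf.dt.dx_eq ht hx,
    fderivWithin_congr (f := fun p : ℝ × ℝ => fderivWithin ℝ (fun p : ℝ × ℝ => f p.1 p.2) strip p
      (0, 1)) (fun p hp => hf.dx_eq hp.1 hp.2) (hf.dx_eq ht hx),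
    fderivWithin_congr (f := fun p : ℝ × ℝ => fderivWithin ℝ (fun p : ℝ × ℝ => f p.1 p.2) strip p
      (1, 0)) (fun p hp => hf.dt_eq hp.1 hp.2) (hf.dt_eq ht hx)]
  have hs : IsSymmSndFDerivWithinAt ℝ (fun p : ℝ × ℝ => f p.1 p.2) strip (t, x) :=
    (hf (t, x) hp).isSymmSndFDerivWithinAt
      (by simpa using WithTop.coe_le_coe.2 (le_top (a := (2 : ℕ∞)))) uniqueDiffOn_strip
      (strip_subset_closure_interior hp) hp
  have e1 := congrArg (fun L => L ((1 : ℝ), (0 : ℝ))) (key (0, 1))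
  have e2 := congrArg (fun L => L ((0 : ℝ), (1 : ℝ))) (key (1, 0))
  simp only [ContinuousLinearMap.flip_apply] at e1 e2
  exact e1.trans ((hs (1, 0) (0, 1)).trans e2.symm)

theorem continuousOn_slice (hf : SmoothOnStrip f) (ht : 0 < t) : ContinuousOn (f t) I :=
  fun _ hx => (hf.hasDerivWithinAt ht hx).continuousWithinAt

theorem intervalIntegrable {f : ℝ → ℝ → ℝ} (hf : SmoothOnStrip f) (ht : 0 < t) :
    IntervalIntegrable (f t) MeasureTheory.volume 0 1 :=
  ContinuousOn.intervalIntegrable (by simpa using hf.continuousOn_slice ht)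

theorem integral_dx {f : ℝ → ℝ → ℝ} (hf : SmoothOnStrip f) (ht : 0 < t) (hx : x ∈ I) :
    ∫ y in (0 : ℝ)..x, ElasticFlow.dx f t y = f t x - f t 0 := by
  have hsub : Icc 0 x ⊆ I := Icc_subset_Icc le_rfl hx.2
  refine intervalIntegral.integral_eq_sub_of_hasDerivAt_of_le hx.1
    ((hf.continuousOn_slice ht).mono hsub) (fun y hy => ?_) ?_
  · have hy' : y ∈ Ioo (0 : ℝ) 1 := ⟨hy.1, hy.2.trans_le hx.2⟩
    exact (hf.hasDerivWithinAt ht (Ioo_subset_Icc_self hy')).hasDerivAt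
      (Icc_mem_nhds hy'.1 hy'.2)
  · apply ContinuousOn.intervalIntegrable
    rw [uIcc_of_le hx.1]
    exact (hf.dx.continuousOn_slice ht).mono hsub

/-- Differentiation under the integral sign; the time derivative is bounded on the compact set
`[t / 2, 2 t] × [0, 1]`. -/
theorem hasDerivAt_integral {f : ℝ → ℝ → ℝ} (hf : SmoothOnStrip f) (ht : 0 < t) :
    HasDerivAt (fun s => ∫ x in (0 : ℝ)..1, f s x)
      (∫ x in (0 : ℝ)..1, ElasticFlow.dt f t x) t := by
  have hK : IsCompact (Icc (t / 2) (2 * t) ×ˢ I) := isCompact_Icc.prod isCompact_Icc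
  have hsub : Icc (t / 2) (2 * t) ×ˢ I ⊆ strip :=
    prod_mono (fun s hs => lt_of_lt_of_le (by positivity) hs.1) subset_rfl
  obtain ⟨C, hC⟩ := hK.exists_bound_of_continuousOn (hf.dt.continuousOn.mono hsub)
  have hnhds : Icc (t / 2) (2 * t) ∈ nhds t := Icc_mem_nhds (by linarith) (by linarith)
  have hmem : ∀ {x}, x ∈ uIoc (0 : ℝ) 1 → x ∈ I := by
    intro x hx
    rw [uIoc_of_le zero_le_one] at hx
    exact Ioc_subset_Icc_self hx
  refine (intervalIntegral.hasDerivAt_integral_of_dominated_loc_of_deriv_le (bound := fun _ => C)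
    hnhds ?_ (hf.intervalIntegrable ht) ?_ ?_ intervalIntegrable_const ?_).2
  · filter_upwards [hnhds] with s hs
    have hs0 : 0 < s := lt_of_lt_of_le (by positivity) hs.1
    have := (hf.intervalIntegrable hs0).aestronglyMeasurable
    rwa [uIoc_of_le zero_le_one]
  · have := (hf.dt.intervalIntegrable ht).aestronglyMeasurable
    rwa [uIoc_of_le zero_le_one]
  · exact Filter.Eventually.of_forall fun x hx s hs => hC (s, x) ⟨hs, hmem hx⟩
  · exact Filter.Eventually.of_forall fun x hx s hs =>
      hf.hasDerivAt (lt_of_lt_of_le (by positivity) hs.1) (hmem hx)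

theorem add {f g : ℝ → ℝ → F} (hf : SmoothOnStrip f) (hg : SmoothOnStrip g) :
    SmoothOnStrip (fun t x => f t x + g t x) := ContDiffOn.add hf hg

theorem sub {f g : ℝ → ℝ → F} (hf : SmoothOnStrip f) (hg : SmoothOnStrip g) :
    SmoothOnStrip (fun t x => f t x - g t x) := ContDiffOn.sub hf hg

theorem mul {f g : ℝ → ℝ → ℝ} (hf : SmoothOnStrip f) (hg : SmoothOnStrip g) :
    SmoothOnStrip (fun t x => f t x * g t x) := ContDiffOn.mul hf hg

theorem pow {f : ℝ → ℝ → ℝ} (hf : SmoothOnStrip f) (n : ℕ) :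
    SmoothOnStrip (fun t x => f t x ^ n) := ContDiffOn.pow hf n

theorem const (c : F) : SmoothOnStrip (fun _ _ => c) := contDiffOn_const

theorem coord {f : ℝ → ℝ → Plane} (hf : SmoothOnStrip f) (i : Fin 2) :
    SmoothOnStrip (fun t x => f t x i) :=
  (EuclideanSpace.proj i : Plane →L[ℝ] ℝ).contDiff.comp_contDiffOn hf

end SmoothOnStrip

theorem hasDerivWithinAt_coord {f : ℝ → Plane} {f' : Plane} {s : Set ℝ} {x : ℝ}
    (h : HasDerivWithinAt f f' s x) (i : Fin 2) :
    HasDerivWithinAt (fun y => f y i) (f' i) s x :=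
  (EuclideanSpace.proj i : Plane →L[ℝ] ℝ).hasFDerivAt.comp_hasDerivWithinAt x h

theorem hasDerivAt_coord {f : ℝ → Plane} {f' : Plane} {x : ℝ}
    (h : HasDerivAt f f' x) (i : Fin 2) :
    HasDerivAt (fun y => f y i) (f' i) x :=
  (EuclideanSpace.proj i : Plane →L[ℝ] ℝ).hasFDerivAt.comp_hasDerivAt x h

namespace SmoothOnStrip

variable {f : ℝ → ℝ → Plane} {t x : ℝ}

theorem hasDerivWithinAt_apply (hf : SmoothOnStrip f) (ht : 0 < t) (hx : x ∈ I) (i : Fin 2) :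
    HasDerivWithinAt (fun y => f t y i) (ElasticFlow.dx f t x i) I x :=
  hasDerivWithinAt_coord (hf.hasDerivWithinAt ht hx) i

theorem hasDerivAt_apply (hf : SmoothOnStrip f) (ht : 0 < t) (hx : x ∈ I) (i : Fin 2) :
    HasDerivAt (fun s => f s x i) (ElasticFlow.dt f t x i) t :=
  hasDerivAt_coord (hf.hasDerivAt ht hx) i

end SmoothOnStrip

/-! ### Plane geometry -/

theorem inner_plane (u w : Plane) : inner ℝ u w = u 0 * w 0 + u 1 * w 1 := by
  simp [PiLp.inner_apply, Fin.sum_univ_two, mul_comm]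

theorem inner_rot (u w : Plane) : inner ℝ u (rot w) = u 1 * w 0 - u 0 * w 1 := by
  rw [inner_plane]; simp [rot]; ring

theorem inner_rot_self (u : Plane) : inner ℝ u (rot u) = (0 : ℝ) := by
  rw [inner_rot]; ring

theorem rot_smul (r : ℝ) (u : Plane) : rot (r • u) = r • rot u := by
  ext i; fin_cases i <;> simp [rot]

theorem derivWithin_eq_speed_smul_tangent {c : ℝ → Plane} {x : ℝ} (h : derivWithin c I x ≠ 0) :
    derivWithin c I x = speed c x • tangent c x := by
  rw [tangent, arcDeriv, smul_smul, speed, mul_inv_cancel₀ (norm_ne_zero_iff.2 h), one_smul]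

theorem norm_tangent {c : ℝ → Plane} {x : ℝ} (h : derivWithin c I x ≠ 0) : ‖tangent c x‖ = 1 := by
  rw [tangent, arcDeriv, norm_smul, norm_inv, speed, norm_norm,
    inv_mul_cancel₀ (norm_ne_zero_iff.2 h)]

theorem tangent_sq_add_sq {c : ℝ → Plane} {x : ℝ} (h : derivWithin c I x ≠ 0) :
    tangent c x 0 ^ 2 + tangent c x 1 ^ 2 = 1 := by
  have := real_inner_self_eq_norm_sq (tangent c x)
  rw [norm_tangent h, inner_plane] at this
  linarith

/-! ### First variation of the elastic energy -/

/-- A family of regular curves which is smooth for positive times, with no equation imposed. -/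
structure IsRegularFamily (Y : ℝ → ℝ → Plane) : Prop where
  smooth : SmoothOnStrip Y
  regular : ∀ t, 0 < t → ∀ x ∈ I, derivWithin (Y t) I x ≠ 0

/-- The normal velocity `V = ⟨∂ₜY, ν⟩`. -/
def normalSpeed (Y : ℝ → ℝ → Plane) (t x : ℝ) : ℝ := inner ℝ (dt Y t x) (normal (Y t) x)

/-- The tangential velocity `Λ = ⟨∂ₜY, τ⟩`. -/
def tangentialSpeed (Y : ℝ → ℝ → Plane) (t x : ℝ) : ℝ := inner ℝ (dt Y t x) (tangent (Y t) x)

/-- The rate `ω = ⟨∂ₜτ, ν⟩` at which the tangent turns in time, that is, the time derivative of the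
tangent angle. -/
def turningRate (Y : ℝ → ℝ → Plane) (t x : ℝ) : ℝ :=
  inner ℝ (dt (fun t => tangent (Y t)) t x) (normal (Y t) x)

/-- The quantity `2κω - κ²Λ - 2(∂ₛκ)V`, whose `x`-derivative is the divergence part of `∂ₜ(κ²|∂ₓY|)`.
It vanishes wherever `κ = V = 0`. -/
def energyFlux (Y : ℝ → ℝ → Plane) (t x : ℝ) : ℝ :=
  2 * (curvature (Y t) x * turningRate Y t x) - curvature (Y t) x ^ 2 * tangentialSpeed Y t x
    - 2 * (arcDeriv (Y t) (curvature (Y t)) x * normalSpeed Y t x)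

namespace IsRegularFamily

variable {F : Type*} [NormedAddCommGroup F] [NormedSpace ℝ F]
variable {Y : ℝ → ℝ → Plane} {t x : ℝ}

theorem smooth_speed (h : IsRegularFamily Y) : SmoothOnStrip (fun t => speed (Y t)) :=
  ContDiffOn.norm ℝ h.smooth.dx fun p hp => h.regular p.1 hp.1 p.2 hp.2

theorem speed_pos (h : IsRegularFamily Y) (ht : 0 < t) (hx : x ∈ I) : 0 < speed (Y t) x :=
  norm_pos_iff.2 (h.regular t ht x hx)

theorem smooth_arcDeriv (h : IsRegularFamily Y) {f : ℝ → ℝ → F} (hf : SmoothOnStrip f) :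
    SmoothOnStrip (fun t => arcDeriv (Y t) (f t)) :=
  ContDiffOn.smul (ContDiffOn.inv h.smooth_speed fun _ hp => (h.speed_pos hp.1 hp.2).ne') hf.dx

theorem dx_eq_speed_mul_arcDeriv (h : IsRegularFamily Y) (f : ℝ → ℝ → ℝ) (ht : 0 < t)
    (hx : x ∈ I) : dx f t x = speed (Y t) x * arcDeriv (Y t) (f t) x := by
  rw [arcDeriv, smul_eq_mul, mul_inv_cancel_left₀ (h.speed_pos ht hx).ne']; rfl

theorem smooth_tangent (h : IsRegularFamily Y) : SmoothOnStrip (fun t => tangent (Y t)) :=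
  h.smooth_arcDeriv h.smooth

theorem smooth_inner_normal (h : IsRegularFamily Y) {f : ℝ → ℝ → Plane} (hf : SmoothOnStrip f) :
    SmoothOnStrip (fun t x => inner ℝ (f t x) (normal (Y t) x)) := by
  refine (((hf.coord 1).mul (h.smooth_tangent.coord 0)).sub
    ((hf.coord 0).mul (h.smooth_tangent.coord 1))).congr fun t _ x _ => ?_
  rw [normal, inner_rot]

theorem smooth_curvature (h : IsRegularFamily Y) : SmoothOnStrip (fun t => curvature (Y t)) :=
  h.smooth_inner_normal (h.smooth_arcDeriv h.smooth_tangent)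

theorem smooth_normalSpeed (h : IsRegularFamily Y) : SmoothOnStrip (normalSpeed Y) :=
  h.smooth_inner_normal h.smooth.dt

theorem smooth_turningRate (h : IsRegularFamily Y) : SmoothOnStrip (turningRate Y) :=
  h.smooth_inner_normal h.smooth_tangent.dt

theorem smooth_tangentialSpeed (h : IsRegularFamily Y) : SmoothOnStrip (tangentialSpeed Y) :=
  ContDiffOn.inner ℝ h.smooth.dt h.smooth_tangent

/-- The Frenet equation `∂ₓτ = |∂ₓY| κ ν` in coordinates. -/
theorem dx_tangent (h : IsRegularFamily Y) (ht : 0 < t) (hx : x ∈ I) :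
    dx (fun t => tangent (Y t)) t x 0 =
        -(speed (Y t) x * curvature (Y t) x * tangent (Y t) x 1) ∧
      dx (fun t => tangent (Y t)) t x 1 =
        speed (Y t) x * curvature (Y t) x * tangent (Y t) x 0 := by
  have hu := tangent_sq_add_sq (h.regular t ht x hx)
  have ha := h.smooth_tangent.hasDerivWithinAt_apply ht hx 0
  have hb := h.smooth_tangent.hasDerivWithinAt_apply ht hx 1
  -- Differentiating `|τ|² = 1` shows that `∂ₓτ` is orthogonal to `τ`.
  have h0 := ((ha.mul ha).add (hb.mul hb)).congr_of_mem (f₁ := fun _ => (1 : ℝ)) (fun y hy => by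
    have := tangent_sq_add_sq (h.regular t ht y hy)
    simp only [Pi.add_apply, Pi.mul_apply]
    linarith) hx
  have horth := (uniqueDiffOn_interval x hx).eq_deriv _ (hasDerivWithinAt_const x I (1 : ℝ)) h0
  have hk : speed (Y t) x * curvature (Y t) x =
      dx (fun t => tangent (Y t)) t x 1 * tangent (Y t) x 0 -
        dx (fun t => tangent (Y t)) t x 0 * tangent (Y t) x 1 := by
    rw [curvature, arcDeriv, real_inner_smul_left, mul_inv_cancel_left₀ (h.speed_pos ht hx).ne',
      normal, inner_rot]
    rfl
  rw [hk]
  constructor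
  · linear_combination (-(dx (fun t => tangent (Y t)) t x 0)) * hu
      - (1 / 2) * tangent (Y t) x 0 * horth
  · linear_combination (-(dx (fun t => tangent (Y t)) t x 1)) * hu
      - (1 / 2) * tangent (Y t) x 1 * horth

/-- The equation `∂ₜτ = ω ν` in coordinates. -/
theorem dt_tangent (h : IsRegularFamily Y) (ht : 0 < t) (hx : x ∈ I) :
    dt (fun t => tangent (Y t)) t x 0 = -(turningRate Y t x * tangent (Y t) x 1) ∧
      dt (fun t => tangent (Y t)) t x 1 = turningRate Y t x * tangent (Y t) x 0 := by
  have hu := tangent_sq_add_sq (h.regular t ht x hx)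
  have ha := h.smooth_tangent.hasDerivAt_apply ht hx 0
  have hb := h.smooth_tangent.hasDerivAt_apply ht hx 1
  have h0 := ((ha.mul ha).add (hb.mul hb)).congr_of_eventuallyEq (f₁ := fun _ => (1 : ℝ)) (by
    filter_upwards [Ioi_mem_nhds ht] with s hs
    have := tangent_sq_add_sq (h.regular s hs x hx)
    simp only [Pi.add_apply, Pi.mul_apply]
    linarith)
  have horth := (hasDerivAt_const t (1 : ℝ)).unique h0
  rw [turningRate, normal, inner_rot]
  constructor
  · linear_combination (-(dt (fun t => tangent (Y t)) t x 0)) * hu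
      - (1 / 2) * tangent (Y t) x 0 * horth
  · linear_combination (-(dt (fun t => tangent (Y t)) t x 1)) * hu
      - (1 / 2) * tangent (Y t) x 1 * horth

theorem dx_dt (h : IsRegularFamily Y) (ht : 0 < t) (hx : x ∈ I) (i : Fin 2) :
    dx (dt Y) t x i = dt (fun t => speed (Y t)) t x * tangent (Y t) x i
      + speed (Y t) x * dt (fun t => tangent (Y t)) t x i := by
  rw [← h.smooth.dt_dx ht hx]
  have h1 := h.smooth.dx.hasDerivAt_apply ht hx i
  have h2 := (h.smooth_speed.hasDerivAt ht hx).mul (h.smooth_tangent.hasDerivAt_apply ht hx i)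
  refine h1.unique (h2.congr_of_eventuallyEq ?_)
  filter_upwards [Ioi_mem_nhds ht] with s hs
  exact congrArg (fun w : Plane => w i) (derivWithin_eq_speed_smul_tangent (h.regular s hs x hx))

theorem dx_normalSpeed (h : IsRegularFamily Y) (ht : 0 < t) (hx : x ∈ I) :
    dx (normalSpeed Y) t x = speed (Y t) x *
      (turningRate Y t x - curvature (Y t) x * tangentialSpeed Y t x) := by
  have hu := tangent_sq_add_sq (h.regular t ht x hx)
  obtain ⟨ha, hb⟩ := h.dx_tangent ht hx
  obtain ⟨ha', hb'⟩ := h.dt_tangent ht hx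
  have hd := ((h.smooth.dt.hasDerivWithinAt_apply ht hx 1).mul
    (h.smooth_tangent.hasDerivWithinAt_apply ht hx 0)).sub
    ((h.smooth.dt.hasDerivWithinAt_apply ht hx 0).mul (h.smooth_tangent.hasDerivWithinAt_apply ht hx 1))
  have he := hd.congr_of_mem (f₁ := normalSpeed Y t)
    (fun y _ => by rw [normalSpeed, normal, inner_rot]; rfl) hx
  rw [(uniqueDiffOn_interval x hx).eq_deriv _ (h.smooth_normalSpeed.hasDerivWithinAt ht hx) he,
    h.dx_dt ht hx, h.dx_dt ht hx, ha, hb, ha', hb', tangentialSpeed, inner_plane]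
  linear_combination (speed (Y t) x * turningRate Y t x) * hu

theorem dx_tangentialSpeed (h : IsRegularFamily Y) (ht : 0 < t) (hx : x ∈ I) :
    dx (tangentialSpeed Y) t x = dt (fun t => speed (Y t)) t x +
      speed (Y t) x * curvature (Y t) x * normalSpeed Y t x := by
  have hu := tangent_sq_add_sq (h.regular t ht x hx)
  obtain ⟨ha, hb⟩ := h.dx_tangent ht hx
  obtain ⟨ha', hb'⟩ := h.dt_tangent ht hx
  have hd := ((h.smooth.dt.hasDerivWithinAt_apply ht hx 0).mul
    (h.smooth_tangent.hasDerivWithinAt_apply ht hx 0)).add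
    ((h.smooth.dt.hasDerivWithinAt_apply ht hx 1).mul (h.smooth_tangent.hasDerivWithinAt_apply ht hx 1))
  have he := hd.congr_of_mem (f₁ := tangentialSpeed Y t)
    (fun y _ => by rw [tangentialSpeed, inner_plane]; rfl) hx
  rw [(uniqueDiffOn_interval x hx).eq_deriv _ (h.smooth_tangentialSpeed.hasDerivWithinAt ht hx) he,
    h.dx_dt ht hx, h.dx_dt ht hx, ha, hb, ha', hb', normalSpeed, normal, inner_rot]
  linear_combination (dt (fun t => speed (Y t)) t x) * hu

/-- With `θ` the tangent angle, this is `∂ₜ∂ₓθ = ∂ₓ∂ₜθ`, since `∂ₓθ = |∂ₓY|κ` and `∂ₜθ = ω`. No choice of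
angle is needed: `|∂ₓY|κ` and `ω` are written as determinants of `τ` with its derivatives. -/
theorem dt_speed_mul_curvature (h : IsRegularFamily Y) (ht : 0 < t) (hx : x ∈ I) :
    dt (fun t => speed (Y t)) t x * curvature (Y t) x +
      speed (Y t) x * dt (fun t => curvature (Y t)) t x = dx (turningRate Y) t x := by
  obtain ⟨ha, hb⟩ := h.dx_tangent ht hx
  obtain ⟨ha', hb'⟩ := h.dt_tangent ht hx
  have hT := h.smooth_tangent
  have hd := ((hT.dt.hasDerivWithinAt_apply ht hx 1).mul (hT.hasDerivWithinAt_apply ht hx 0)).sub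
    ((hT.dt.hasDerivWithinAt_apply ht hx 0).mul (hT.hasDerivWithinAt_apply ht hx 1))
  have he := hd.congr_of_mem (f₁ := turningRate Y t)
    (fun y _ => by rw [turningRate, normal, inner_rot]; rfl) hx
  have kd := ((hT.dx.hasDerivAt_apply ht hx 1).mul (hT.hasDerivAt_apply ht hx 0)).sub
    ((hT.dx.hasDerivAt_apply ht hx 0).mul (hT.hasDerivAt_apply ht hx 1))
  have ke := kd.congr_of_eventuallyEq (f₁ := fun s => speed (Y s) x * curvature (Y s) x) (by
    filter_upwards [Ioi_mem_nhds ht] with s hs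
    rw [curvature, arcDeriv, real_inner_smul_left, mul_inv_cancel_left₀ (h.speed_pos hs hx).ne',
      normal, inner_rot]
    rfl)
  rw [(uniqueDiffOn_interval x hx).eq_deriv _ (h.smooth_turningRate.hasDerivWithinAt ht hx) he,
    ((h.smooth_speed.hasDerivAt ht hx).mul (h.smooth_curvature.hasDerivAt ht hx)).unique ke,
    hT.dt_dx ht hx, ha, hb, ha', hb']
  ring

theorem smooth_energyFlux (h : IsRegularFamily Y) : SmoothOnStrip (energyFlux Y) :=
  (((SmoothOnStrip.const (2 : ℝ)).mul (h.smooth_curvature.mul h.smooth_turningRate)).sub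
    ((h.smooth_curvature.pow 2).mul h.smooth_tangentialSpeed)).sub
    ((SmoothOnStrip.const (2 : ℝ)).mul
      ((h.smooth_arcDeriv h.smooth_curvature).mul h.smooth_normalSpeed))

theorem smooth_energyDensity (h : IsRegularFamily Y) :
    SmoothOnStrip (fun t x => curvature (Y t) x ^ 2 * speed (Y t) x) :=
  (h.smooth_curvature.pow 2).mul h.smooth_speed

/-- The first variation of the elastic energy in divergence form,
`∂ₜ(κ²|∂ₓY|) = ∂ₓ(2κω - κ²Λ - 2(∂ₛκ)V) + (2∂ₛ²κ + κ³) V |∂ₓY|`. The tangential velocity enters only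
through the flux. -/
theorem dt_energyDensity (h : IsRegularFamily Y) (ht : 0 < t) (hx : x ∈ I) :
    dt (fun t x => curvature (Y t) x ^ 2 * speed (Y t) x) t x =
      dx (energyFlux Y) t x +
        (2 * arcDeriv (Y t) (arcDeriv (Y t) (curvature (Y t))) x + curvature (Y t) x ^ 3) *
          normalSpeed Y t x * speed (Y t) x := by
  have hk := h.smooth_curvature
  have hks := h.smooth_arcDeriv hk
  have e1 := ((hk.hasDerivAt ht hx).pow 2).mul (h.smooth_speed.hasDerivAt ht hx)
  have e2 := ((((hk.hasDerivWithinAt ht hx).mul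
      (h.smooth_turningRate.hasDerivWithinAt ht hx)).const_mul 2).sub
    (((hk.hasDerivWithinAt ht hx).pow 2).mul
      (h.smooth_tangentialSpeed.hasDerivWithinAt ht hx))).sub
    (((hks.hasDerivWithinAt ht hx).mul
      (h.smooth_normalSpeed.hasDerivWithinAt ht hx)).const_mul 2)
  rw [(h.smooth_energyDensity.hasDerivAt ht hx).unique e1,
    (uniqueDiffOn_interval x hx).eq_deriv _ (h.smooth_energyFlux.hasDerivWithinAt ht hx) e2,
    h.dx_normalSpeed ht hx, h.dx_tangentialSpeed ht hx, ← h.dt_speed_mul_curvature ht hx,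
    h.dx_eq_speed_mul_arcDeriv _ ht hx, h.dx_eq_speed_mul_arcDeriv _ ht hx]
  simp only [Pi.pow_apply]
  push_cast
  ring

end IsRegularFamily

/-! ### Curvature of `C²` curves and the elastic energy -/

/-- Clamping `t` to `[0, ∞)` and `x` to `[0, 1]` makes the integrand continuous on the whole plane. -/
theorem continuousOn_intervalIntegral_of_continuousOn {f : ℝ → ℝ → ℝ}
    (hf : ContinuousOn (fun p : ℝ × ℝ => f p.1 p.2) (Ici 0 ×ˢ I)) :
    ContinuousOn (fun t => ∫ x in (0 : ℝ)..1, f t x) (Ici 0) := by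
  have hc : Continuous fun p : ℝ × ℝ => (max p.1 0, max 0 (min p.2 1)) := by fun_prop
  have hm : ∀ p : ℝ × ℝ, (max p.1 0, max 0 (min p.2 1)) ∈ Ici (0 : ℝ) ×ˢ I := fun p =>
    ⟨mem_Ici.2 (le_max_right _ _), le_max_left _ _, max_le zero_le_one (min_le_right _ _)⟩
  have hF : Continuous (Function.uncurry fun t x : ℝ => f (max t 0) (max 0 (min x 1))) :=
    hf.comp_continuous hc hm
  have hI := intervalIntegral.continuous_parametric_intervalIntegral_of_continuous'
    (μ := MeasureTheory.volume) hF 0 1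
  refine hI.continuousOn.congr fun t ht => ?_
  refine intervalIntegral.integral_congr fun x hx => ?_
  rw [uIcc_of_le zero_le_one] at hx
  simp only [max_eq_left (mem_Ici.1 ht), min_eq_left hx.2, max_eq_right hx.1]

theorem iteratedDerivWithin_two {c : ℝ → Plane} :
    iteratedDerivWithin 2 c I = derivWithin (derivWithin c I) I := by
  change iteratedDerivWithin (1 + 1) c I = _
  rw [iteratedDerivWithin_succ', iteratedDerivWithin_one]

/-- `κ = |∂ₓc|⁻³ ⟨∂ₓ²c, R ∂ₓc⟩` with `R` the rotation `rot`. Only derivatives of order at most two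
occur, so this controls the curvature of a solution down to the initial time. -/
theorem curvature_eq {c : ℝ → Plane} (hc : ContDiffOn ℝ 2 c I) {x : ℝ} (hx : x ∈ I)
    (hreg : derivWithin c I x ≠ 0) :
    curvature c x = (speed c x)⁻¹ ^ 3 *
      inner ℝ (iteratedDerivWithin 2 c I x) (rot (iteratedDerivWithin 1 c I x)) := by
  have hu := uniqueDiffOn_interval
  have h1 : DifferentiableWithinAt ℝ (derivWithin c I) I x :=
    (hc.derivWithin hu (m := 1) (by norm_num)).differentiableOn (by norm_num) x hx
  have h2 : DifferentiableWithinAt ℝ (fun y => (speed c y)⁻¹) I x :=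
    (h1.norm ℝ hreg).inv (norm_ne_zero_iff.2 hreg)
  have h3 := h2.hasDerivWithinAt.smul h1.hasDerivWithinAt
  have h4 : derivWithin (tangent c) I x =
      (speed c x)⁻¹ • derivWithin (derivWithin c I) I x +
        derivWithin (fun y => (speed c y)⁻¹) I x • derivWithin c I x :=
    h3.derivWithin (hu x hx)
  have hT : tangent c x = (speed c x)⁻¹ • derivWithin c I x := rfl
  rw [curvature, normal, arcDeriv, h4, hT, rot_smul,
    iteratedDerivWithin_two, iteratedDerivWithin_one, real_inner_smul_left, real_inner_smul_right,
    inner_add_left, real_inner_smul_left, real_inner_smul_left, inner_rot_self]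
  ring

theorem eqOn_derivWithin {F : Type*} [NormedAddCommGroup F] [NormedSpace ℝ F] {f g : ℝ → F}
    (h : EqOn f g I) : EqOn (derivWithin f I) (derivWithin g I) I :=
  fun _ hx => derivWithin_congr h (h hx)

theorem eqOn_speed {c d : ℝ → Plane} (h : EqOn c d I) : EqOn (speed c) (speed d) I :=
  fun _ hx => congrArg norm (eqOn_derivWithin h hx)

theorem eqOn_arcDeriv {F : Type*} [NormedAddCommGroup F] [NormedSpace ℝ F] {c d : ℝ → Plane}
    {f g : ℝ → F} (h : EqOn c d I) (hfg : EqOn f g I) :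
    EqOn (arcDeriv c f) (arcDeriv d g) I := fun x hx => by
  rw [arcDeriv, arcDeriv, eqOn_speed h hx, eqOn_derivWithin hfg hx]

theorem eqOn_curvature {c d : ℝ → Plane} (h : EqOn c d I) : EqOn (curvature c) (curvature d) I :=
  fun x hx => by
    rw [curvature, curvature, normal, normal, tangent, tangent,
      eqOn_arcDeriv h (eqOn_arcDeriv h h) hx, eqOn_arcDeriv h h hx]

/-- The elastic energy `∫_c κ² ds`. -/
def bendingEnergy (c : ℝ → Plane) : ℝ := arcIntegral c (fun x => curvature c x ^ 2)

theorem bendingEnergy_congr {c d : ℝ → Plane} (h : EqOn c d I) :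
    bendingEnergy c = bendingEnergy d := by
  refine intervalIntegral.integral_congr fun x hx => ?_
  rw [uIcc_of_le zero_le_one] at hx
  simp only [eqOn_curvature h hx, eqOn_speed h hx]

theorem bendingEnergy_nonneg (c : ℝ → Plane) : 0 ≤ bendingEnergy c :=
  intervalIntegral.integral_nonneg zero_le_one fun _ _ =>
    mul_nonneg (sq_nonneg _) (norm_nonneg _)

/-- The integral `∫_c (∂ₛκ)² ds`. -/
def derivEnergy (c : ℝ → Plane) : ℝ := arcIntegral c (fun x => arcDeriv c (curvature c) x ^ 2)

/-! ### Interpolation -/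

namespace IsRegularFamily

variable {Y : ℝ → ℝ → Plane} {t x r : ℝ}

/-- A curvature vanishing at `x = 0` satisfies `κ(x)² = ∫₀ˣ 2κ ∂ₛκ ds`, and
`2κ ∂ₛκ ≤ r κ² + r⁻¹ (∂ₛκ)²`. The bound does not involve the length of the curve. -/
theorem curvature_sq_le (h : IsRegularFamily Y) (ht : 0 < t) (hx : x ∈ I)
    (h0 : curvature (Y t) 0 = 0) (hr : 0 < r) :
    curvature (Y t) x ^ 2 ≤ r * bendingEnergy (Y t) + r⁻¹ * derivEnergy (Y t) := by
  have hk := h.smooth_curvature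
  have hks := h.smooth_arcDeriv hk
  have hv := h.smooth_speed
  have s1 := h.smooth_energyDensity
  have s2 := (hks.pow 2).mul hv
  have sg := ((SmoothOnStrip.const r).mul s1).add ((SmoothOnStrip.const r⁻¹).mul s2)
  have hsub : Icc 0 x ⊆ I := Icc_subset_Icc le_rfl hx.2
  have key : ∫ y in (0 : ℝ)..x, dx (fun t x => curvature (Y t) x ^ 2) t y ≤
      ∫ y in (0 : ℝ)..x, (r * (curvature (Y t) y ^ 2 * speed (Y t) y) +
        r⁻¹ * (arcDeriv (Y t) (curvature (Y t)) y ^ 2 * speed (Y t) y)) := by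
    refine intervalIntegral.integral_mono_on hx.1 ?_ ?_ fun y hy => ?_
    · apply ContinuousOn.intervalIntegrable
      rw [uIcc_of_le hx.1]
      exact ((hk.pow 2).dx.continuousOn_slice ht).mono hsub
    · apply ContinuousOn.intervalIntegrable
      rw [uIcc_of_le hx.1]
      exact (sg.continuousOn_slice ht).mono hsub
    · have hyI := hsub hy
      rw [(uniqueDiffOn_interval y hyI).eq_deriv _ ((hk.pow 2).hasDerivWithinAt ht hyI)
        ((hk.hasDerivWithinAt ht hyI).pow 2), h.dx_eq_speed_mul_arcDeriv _ ht hyI]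
      have hp := h.speed_pos ht hyI
      have := mul_nonneg (mul_nonneg hp.le (inv_nonneg.2 hr.le))
        (sq_nonneg (r * curvature (Y t) y - arcDeriv (Y t) (curvature (Y t)) y))
      have e : speed (Y t) y * r⁻¹ *
          (r * curvature (Y t) y - arcDeriv (Y t) (curvature (Y t)) y) ^ 2 =
          r * (curvature (Y t) y ^ 2 * speed (Y t) y) +
            r⁻¹ * (arcDeriv (Y t) (curvature (Y t)) y ^ 2 * speed (Y t) y) -
          2 * curvature (Y t) y * (speed (Y t) y * arcDeriv (Y t) (curvature (Y t)) y) := by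
        field_simp
        ring
      simp only [Nat.cast_ofNat, Nat.add_one_sub_one, pow_one]
      linarith
  rw [(hk.pow 2).integral_dx ht hx] at key
  have mono : ∫ y in (0 : ℝ)..x, (r * (curvature (Y t) y ^ 2 * speed (Y t) y) +
        r⁻¹ * (arcDeriv (Y t) (curvature (Y t)) y ^ 2 * speed (Y t) y)) ≤
      ∫ y in (0 : ℝ)..1, (r * (curvature (Y t) y ^ 2 * speed (Y t) y) +
        r⁻¹ * (arcDeriv (Y t) (curvature (Y t)) y ^ 2 * speed (Y t) y)) := by
    refine intervalIntegral.integral_mono_interval le_rfl hx.1 hx.2 ?_ (sg.intervalIntegrable ht)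
    refine Filter.Eventually.of_forall fun y => ?_
    have := norm_nonneg (derivWithin (Y t) I y)
    simp only [Pi.zero_apply, speed]
    positivity
  rw [intervalIntegral.integral_add ((s1.intervalIntegrable ht).const_mul r)
    ((s2.intervalIntegrable ht).const_mul r⁻¹), intervalIntegral.integral_const_mul,
    intervalIntegral.integral_const_mul] at mono
  simp only [h0] at key
  simp only [bendingEnergy, derivEnergy, arcIntegral]
  linarith

/-- Interpolation: the quartic term is absorbed by `2 ∫ (∂ₛκ)² ds` up to a cubic power of the energy. -/
theorem integral_curvature_pow_four_le (h : IsRegularFamily Y) (ht : 0 < t)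
    (h0 : curvature (Y t) 0 = 0) :
    ∫ x in (0 : ℝ)..1, curvature (Y t) x ^ 4 * speed (Y t) x ≤
      2 * derivEnergy (Y t) + (bendingEnergy (Y t) + 1) ^ 3 / 2 := by
  have hE := bendingEnergy_nonneg (Y t)
  have hD : 0 ≤ derivEnergy (Y t) := intervalIntegral.integral_nonneg zero_le_one fun _ _ =>
    mul_nonneg (sq_nonneg _) (norm_nonneg _)
  set E := bendingEnergy (Y t)
  set D := derivEnergy (Y t)
  -- The weight `r = (E + 1) / 2` turns `r⁻¹ D E` into at most `2 D`; the `1` avoids dividing by zero.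
  have hr : 0 < (E + 1) / 2 := by positivity
  have h1 : ∫ x in (0 : ℝ)..1, curvature (Y t) x ^ 4 * speed (Y t) x ≤
      ∫ x in (0 : ℝ)..1, ((E + 1) / 2 * E + ((E + 1) / 2)⁻¹ * D) *
        (curvature (Y t) x ^ 2 * speed (Y t) x) := by
    refine intervalIntegral.integral_mono_on zero_le_one
      (((h.smooth_curvature.pow 4).mul h.smooth_speed).intervalIntegrable ht)
      ((h.smooth_energyDensity.intervalIntegrable ht).const_mul _) fun x hx => ?_
    have := mul_le_mul_of_nonneg_right (h.curvature_sq_le ht hx h0 hr)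
      (mul_nonneg (sq_nonneg (curvature (Y t) x)) (h.speed_pos ht hx).le)
    calc curvature (Y t) x ^ 4 * speed (Y t) x
        = curvature (Y t) x ^ 2 * (curvature (Y t) x ^ 2 * speed (Y t) x) := by ring
      _ ≤ _ := this
  rw [intervalIntegral.integral_const_mul] at h1
  refine h1.trans ?_
  change ((E + 1) / 2 * E + ((E + 1) / 2)⁻¹ * D) * E ≤ _
  have e1 : ((E + 1) / 2)⁻¹ * D * E ≤ 2 * D := by
    have : ((E + 1) / 2)⁻¹ * E ≤ 2 := by
      rw [inv_mul_le_iff₀ hr]; linarith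
    nlinarith
  have e2 : (E + 1) / 2 * E * E ≤ (E + 1) ^ 3 / 2 := by nlinarith [mul_nonneg hE hE]
  linarith

end IsRegularFamily

/-! ### Energy estimate along the flow -/

theorem dt_eq_zero_of_const {Y : ℝ → ℝ → Plane} {t x : ℝ} {y : Plane} (h : ∀ s, 0 ≤ s → Y s x = y)
    (ht : 0 < t) :
    dt Y t x = 0 := by
  have : (fun s => Y s x) =ᶠ[nhds t] fun _ => y := by
    filter_upwards [Ioi_mem_nhds ht] with s hs using h s (le_of_lt hs)
  rw [dt, this.deriv_eq, deriv_const]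

namespace IsSolution

variable {ε : ℝ} {P Q : Plane} {c₀ : ℝ → Plane} {Y : ℝ → ℝ → Plane} {t x : ℝ}

theorem isRegularFamily (hY : IsSolution ε P Q c₀ Y) : IsRegularFamily Y :=
  ⟨hY.smooth, fun t ht => hY.regular t ht.le⟩

theorem normalSpeed_eq (hY : IsSolution ε P Q c₀ Y) (ht : 0 < t) (hx : x ∈ I) :
    normalSpeed Y t x = curvature (Y t) x
      - ε * (2 * arcDeriv (Y t) (arcDeriv (Y t) (curvature (Y t))) x
        + curvature (Y t) x ^ 3) := by
  have hu := tangent_sq_add_sq (hY.regular t ht.le x hx)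
  have hn : inner ℝ (normal (Y t) x) (normal (Y t) x) = (1 : ℝ) := by
    rw [inner_plane, normal]; simp [rot]; linarith
  have h := congrArg (fun w => inner ℝ w (normal (Y t) x)) (hY.evolution t ht x hx)
  simp only [perpPart, inner_sub_left, real_inner_smul_left, hn] at h
  rw [normal, inner_rot_self, mul_zero, sub_zero, mul_one] at h
  exact h

/-- The differential inequality `E' ≤ (E + 1)³ / 2`, uniform in `ε ≥ 0`: for `m = 2∂ₛ²κ + κ³`, the
integrand `m V = m κ - ε m²` of the first variation is at most `m κ`. -/
theorem hasDerivAt_bendingEnergy (hY : IsSolution ε P Q c₀ Y) (hε : 0 ≤ ε) (ht : 0 < t) :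
    ∃ E', HasDerivAt (fun s => bendingEnergy (Y s)) E' t ∧
      E' ≤ (bendingEnergy (Y t) + 1) ^ 3 / 2 := by
  have h := hY.isRegularFamily
  have hk := h.smooth_curvature
  have hks := h.smooth_arcDeriv hk
  have hv := h.smooth_speed
  refine ⟨_, h.smooth_energyDensity.hasDerivAt_integral ht, ?_⟩
  have sk := (SmoothOnStrip.const (2 : ℝ)).mul (hk.mul hks)
  have sH := h.smooth_energyFlux.add sk
  have s4 := (hk.pow 4).mul hv
  have s2 := (SmoothOnStrip.const (2 : ℝ)).mul ((hks.pow 2).mul hv)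
  have key : ∫ x in (0 : ℝ)..1, dt (fun t x => curvature (Y t) x ^ 2 * speed (Y t) x) t x ≤
      ∫ x in (0 : ℝ)..1, (dx (fun t x => energyFlux Y t x +
          2 * (curvature (Y t) x * arcDeriv (Y t) (curvature (Y t)) x)) t x +
        curvature (Y t) x ^ 4 * speed (Y t) x -
        2 * (arcDeriv (Y t) (curvature (Y t)) x ^ 2 * speed (Y t) x)) := by
    refine intervalIntegral.integral_mono_on zero_le_one
      (h.smooth_energyDensity.dt.intervalIntegrable ht)
      (((sH.dx.add s4).sub s2).intervalIntegrable ht) fun x hx => ?_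
    rw [h.dt_energyDensity ht hx, hY.normalSpeed_eq ht hx,
      (uniqueDiffOn_interval x hx).eq_deriv _ (sH.hasDerivWithinAt ht hx)
        ((h.smooth_energyFlux.hasDerivWithinAt ht hx).add
          (((hk.hasDerivWithinAt ht hx).mul (hks.hasDerivWithinAt ht hx)).const_mul 2)),
      h.dx_eq_speed_mul_arcDeriv (fun t => curvature (Y t)) ht hx,
      h.dx_eq_speed_mul_arcDeriv (fun t => arcDeriv (Y t) (curvature (Y t))) ht hx]
    -- The discarded term `-ε (2∂ₛ²κ + κ³)² |∂ₓY|` is the only one that involves `ε`.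
    have := mul_nonneg (mul_nonneg hε (h.speed_pos ht hx).le)
      (sq_nonneg (2 * arcDeriv (Y t) (arcDeriv (Y t) (curvature (Y t))) x
        + curvature (Y t) x ^ 3))
    linarith
  have hl : (0 : ℝ) ∈ I := left_mem_Icc.2 zero_le_one
  have hr : (1 : ℝ) ∈ I := right_mem_Icc.2 zero_le_one
  have k0 := hY.curvature_left t ht.le
  have k1 := hY.curvature_right t ht.le
  -- The endpoints of the curves do not move, so the normal velocity vanishes there.
  have V0 : normalSpeed Y t 0 = 0 := by
    rw [normalSpeed, dt_eq_zero_of_const hY.left ht, inner_zero_left]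
  have V1 : normalSpeed Y t 1 = 0 := by
    rw [normalSpeed, dt_eq_zero_of_const hY.right ht, inner_zero_left]
  rw [intervalIntegral.integral_sub ((sH.dx.add s4).intervalIntegrable ht)
      (s2.intervalIntegrable ht),
    intervalIntegral.integral_add (sH.dx.intervalIntegrable ht) (s4.intervalIntegrable ht),
    sH.integral_dx ht hr, intervalIntegral.integral_const_mul, energyFlux, energyFlux,
    k0, k1, V0, V1] at key
  have h4 := h.integral_curvature_pow_four_le ht k0
  simp only [derivEnergy, arcIntegral] at h4
  linarith

theorem contDiffOn_two (hY : IsSolution ε P Q c₀ Y) (hc₀ : ContDiffOn ℝ 2 c₀ I) (ht : 0 ≤ t) :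
    ContDiffOn ℝ 2 (Y t) I := by
  rcases ht.eq_or_lt with rfl | ht
  · exact hc₀.congr hY.initial
  · have hm : MapsTo (fun x : ℝ => (t, x)) I strip := fun x hx => ⟨ht, hx⟩
    exact ((hY.smooth.of_le (by simpa using WithTop.coe_le_coe.2 (le_top (a := (2 : ℕ∞))))).comp
      (contDiffOn_const.prodMk contDiffOn_id) hm)

theorem continuousOn_bendingEnergy (hY : IsSolution ε P Q c₀ Y) (hc₀ : ContDiffOn ℝ 2 c₀ I) :
    ContinuousOn (fun t => bendingEnergy (Y t)) (Ici 0) := by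
  have h1 := hY.continuousOn 1 (by norm_num)
  have h2 := hY.continuousOn 2 le_rfl
  have hv : ContinuousOn (fun p : ℝ × ℝ => speed (Y p.1) p.2) (Ici 0 ×ˢ I) := 
    h1.norm.congr fun p _ => by
      simp only [iteratedDerivWithin_one, speed]
  have hrot : Continuous rot := by
    unfold rot; fun_prop
  have hk : ContinuousOn (fun p : ℝ × ℝ => curvature (Y p.1) p.2) (Ici 0 ×ˢ I) :=
    (((hv.inv₀ fun p hp => norm_ne_zero_iff.2 (hY.regular p.1 hp.1 p.2 hp.2)).pow 3).mul
      (h2.inner (hrot.comp_continuousOn h1))).congr fun p hp =>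
        curvature_eq (hY.contDiffOn_two hc₀ hp.1) hp.2 (hY.regular p.1 hp.1 p.2 hp.2)
  exact continuousOn_intervalIntegral_of_continuousOn
    (f := fun t x => curvature (Y t) x ^ 2 * speed (Y t) x) ((hk.pow 2).mul hv)

/-- By the differential inequality, `(E + 1)⁻² + t` is nondecreasing along the flow, and
`E ≤ (E + 1)²` removes the square. -/
theorem bendingEnergy_le (hY : IsSolution ε P Q c₀ Y) (hc₀ : ContDiffOn ℝ 2 c₀ I) (hε : 0 ≤ ε)
    {T : ℝ} (hT : T < ((bendingEnergy c₀ + 1) ^ 2)⁻¹) (ht : 0 ≤ t) (htT : t ≤ T) :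
    bendingEnergy (Y t) ≤ (((bendingEnergy c₀ + 1) ^ 2)⁻¹ - T)⁻¹ := by
  have hpos : ∀ s, 0 < bendingEnergy (Y s) + 1 := fun s => by
    linarith [bendingEnergy_nonneg (Y s)]
  have hcont : ContinuousOn (fun s => ((bendingEnergy (Y s) + 1) ^ 2)⁻¹ + s) (Ici 0) :=
    ((((hY.continuousOn_bendingEnergy hc₀).add continuousOn_const).pow 2).inv₀
      fun s _ => (pow_pos (hpos s) 2).ne').add continuousOn_id
  have hder : ∀ s, 0 < s → ∃ d, 0 ≤ d ∧
      HasDerivAt (fun s => ((bendingEnergy (Y s) + 1) ^ 2)⁻¹ + s) d s := by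
    intro s hs
    obtain ⟨E', hE', hle⟩ := hY.hasDerivAt_bendingEnergy hε hs
    refine ⟨_, ?_, (((hE'.add_const 1).pow 2).inv (pow_pos (hpos s) 2).ne').add (hasDerivAt_id s)⟩
    have hp := hpos s
    simp only [Pi.pow_apply, Nat.cast_ofNat, Nat.add_one_sub_one, pow_one]
    rw [← sub_le_iff_le_add, zero_sub, neg_div, neg_le_neg_iff, div_le_one (by positivity)]
    nlinarith
  have hmono : MonotoneOn (fun s => ((bendingEnergy (Y s) + 1) ^ 2)⁻¹ + s) (Ici 0) := by
    refine monotoneOn_of_deriv_nonneg (convex_Ici 0) hcont ?_ ?_ <;> rw [interior_Ici]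
    · intro s hs
      obtain ⟨d, -, hd⟩ := hder s hs
      exact hd.differentiableAt.differentiableWithinAt
    · intro s hs
      obtain ⟨d, hd0, hd⟩ := hder s hs
      rwa [hd.deriv]
  have h := hmono (mem_Ici.2 le_rfl) (mem_Ici.2 ht) ht
  simp only [add_zero, bendingEnergy_congr hY.initial] at h
  have hgap : 0 < ((bendingEnergy c₀ + 1) ^ 2)⁻¹ - T := sub_pos.2 hT
  have h2 : ((bendingEnergy c₀ + 1) ^ 2)⁻¹ - T ≤ ((bendingEnergy (Y t) + 1) ^ 2)⁻¹ := by linarith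
  have h3 := (le_inv_comm₀ hgap (pow_pos (hpos t) 2)).1 h2
  nlinarith [bendingEnergy_nonneg (Y t)]

end IsSolution
end ElasticFlow
end

theorem proposition3p4 (α : ℝ≥0) (hα₀ : 0 < α) (hα₁ : α < 1)
    (P Q : ElasticFlow.Plane) (c₀ : ℝ → ElasticFlow.Plane)
    (hc₀ : ElasticFlow.IsInitialCurve α P Q c₀) :
    ∃ Tmax : ℝ, 0 < Tmax ∧ ∀ T : ℝ, 0 < T → T < Tmax →
      ∃ C : ℝ, ∀ ε : ℝ, 0 < ε → ε ≤ 1 →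
        ∀ Y : ℝ → ℝ → ElasticFlow.Plane, ElasticFlow.IsSolution ε P Q c₀ Y →
          ∀ t : ℝ, 0 ≤ t → t ≤ T →
            ElasticFlow.arcIntegral (Y t)
              (fun x => ElasticFlow.curvature (Y t) x ^ 2) ≤ C := by
  have hE := ElasticFlow.bendingEnergy_nonneg c₀
  refine ⟨((ElasticFlow.bendingEnergy c₀ + 1) ^ 2)⁻¹, by positivity, fun T _ hT =>
    ⟨(((ElasticFlow.bendingEnergy c₀ + 1) ^ 2)⁻¹ - T)⁻¹, fun ε hε _ Y hY t ht htT => ?_⟩⟩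
  exact hY.bendingEnergy_le (hc₀.contDiffOn.of_le (by norm_num)) hε.le hT ht htT
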